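/- Let ${\cal A}$ be a von Neumann algebra with a finite normal faithful trace $\tau$, let ${\cal A}_h$ be its real Banach space of selfadjoint elements (operator norm), and let $\Sigma$ be the set of positive invertible elements of ${\cal A}$, an open subset of ${\cal A}_h$ with tangent spaces ${\cal A}_h$. Equip $\Sigma$ with the metric $$\langle x,y\rangle_a=\tau(xa^{-1}ya^{-1}),\qquad a\in\Sigma,\ x,y\in{\cal A}_h,$$ and for $a,b\in\Sigma$ let $$dist(a,b)=\inf_\alpha\int_0^1\langle\dot\alpha(t),\dot\alpha(t)\rangle_{\alpha(t)}^{1/2}\,dt,$$ where $\alpha:[0,1]\to\Sigma$ ranges over the curves from $a$ to $b$ that are differentiable in the norm topology and have integrable speed. A geodesic of $\Sigma$ on an interval $I\subseteq\mathbb R$ is a curve $\gamma:I\to\Sigma$, twice differentiable in the norm topology, that solves Euler's equation $\nabla_{\dot\gamma}\dot\gamma=0$, where $\nabla_{\dot\gamma}V=\dot V-\frac12(\dot\gamma\gamma^{-1}V+V\gamma^{-1}\dot\gamma)$; that is, $\ddot\gamma=\dot\gamma\gamma^{-1}\dot\gamma$. If $\gamma$ and $\delta$ are geodesics of $\Sigma$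 on the same interval $I$, then $t\mapsto dist(\gamma(t),\delta(t))$ is a convex function on $I$. -/

import Mathlib

open Set

namespace PositiveCone

noncomputable section

variable {A : Type*} [NormedRing A] [NormedAlgebra ℂ A] [StarRing A] [PartialOrder A]

/-- A finite, normal, faithful trace, given as a linear functional: it is nonnegative on positive
elements, vanishes on no nonzero positive element, satisfies `τ (a * b) = τ (b * a)`, and preserves
suprema of bounded increasing nets (upward directed families) of positive elements.
It is not required to be normalized; tracial states are the case `τ 1 = 1`. -/
structure IsFiniteNormalFaithfulTrace (τ : A →ₗ[ℂ] ℂ) : Prop where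
  nonneg : ∀ a : A, 0 ≤ a → 0 ≤ (τ a).re ∧ (τ a).im = 0
  faithful : ∀ a : A, 0 ≤ a → τ a = 0 → a = 0
  tracial : ∀ a b : A, τ (a * b) = τ (b * a)
  normal : ∀ (D : Set A) (s : A), D.Nonempty → DirectedOn (· ≤ ·) D → (∀ d ∈ D, 0 ≤ d) →
    IsLUB D s → IsLUB ((fun d => (τ d).re) '' D) (τ s).re

/-- The manifold of positive invertible elements, an open subset of the real Banach space of
selfadjoint elements. -/
def cone (A : Type*) [NormedRing A] [PartialOrder A] : Set A :=
  {a | 0 ≤ a ∧ IsUnit a}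

/-- The metric `⟨x, y⟩_a = τ (x a⁻¹ y a⁻¹)`, for `a` in the cone and `x`, `y` selfadjoint
(for a trace this number is then real). -/
def metric (τ : A →ₗ[ℂ] ℂ) (a x y : A) : ℝ :=
  (τ (x * Ring.inverse a * y * Ring.inverse a)).re

/-- The norm of the velocity `γ'(t)`, for a curve parametrized by `[0, 1]`. The derivative is
taken in the norm topology, one-sidedly at the end points. -/
def speed (τ : A →ₗ[ℂ] ℂ) (γ : ℝ → A) (t : ℝ) : ℝ :=
  Real.sqrt (metric τ (γ t) (derivWithin γ (Icc 0 1) t) (derivWithin γ (Icc 0 1) t))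

/-- The length of a curve parametrized by `[0, 1]`. -/
def length (τ : A →ₗ[ℂ] ℂ) (γ : ℝ → A) : ℝ :=
  ∫ t in (0 : ℝ)..1, speed τ γ t

/-- `γ`, restricted to `[0, 1]`, is a curve in the cone from `a` to `b` that is differentiable
in the norm topology and whose speed is integrable (so that its length is defined). -/
structure IsCurveJoining (τ : A →ₗ[ℂ] ℂ) (γ : ℝ → A) (a b : A) : Prop where
  mem_cone : ∀ t ∈ Icc (0 : ℝ) 1, γ t ∈ cone A
  differentiable : DifferentiableOn ℝ γ (Icc 0 1)
  rectifiable : IntervalIntegrable (speed τ γ) MeasureTheory.volume 0 1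
  source : γ 0 = a
  target : γ 1 = b

/-- The Riemannian distance: the infimum of the lengths of the curves joining `a` and `b`. -/
def dist (τ : A →ₗ[ℂ] ℂ) (a b : A) : ℝ :=
  sInf {ℓ : ℝ | ∃ γ : ℝ → A, IsCurveJoining τ γ a b ∧ length τ γ = ℓ}

/-- The covariant derivative of a vector field `V` along the curve `γ`, both parametrized by the
interval `I`: `V' - (γ' γ⁻¹ V + V γ⁻¹ γ') / 2`. -/
def covariantDeriv (I : Set ℝ) (γ V : ℝ → A) (t : ℝ) : A :=
  derivWithin V I t - (1 / 2 : ℝ) •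
    (derivWithin γ I t * Ring.inverse (γ t) * V t + V t * Ring.inverse (γ t) * derivWithin γ I t)

/-- Geodesics parametrized by the interval `I`: twice differentiable curves in the cone that solve
Euler's equation `∇_{γ'} γ' = 0`, that is, `γ'' = γ' γ⁻¹ γ'`. -/
structure IsGeodesicOn (I : Set ℝ) (γ : ℝ → A) : Prop where
  mem_cone : ∀ t ∈ I, γ t ∈ cone A
  differentiable : DifferentiableOn ℝ γ I
  differentiable_deriv : DifferentiableOn ℝ (derivWithin γ I) I
  euler : ∀ t ∈ I, covariantDeriv I γ (derivWithin γ I) t = 0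

end

end PositiveCone

/-! The space is nonpositively curved, and this appears in one infinitesimal inequality: squaring
expands the metric by a factor of at least 2 in norm (`four_mul_metric_le`), so square roots halve
distances (`dist_sqrt_le`). Since congruences `x ↦ g * x * g` do not increase distances, the same
bound holds for the symmetric points of a fixed `a`: `d(x, y) ≤ d(x a⁻¹ x, y a⁻¹ y) / 2`
(`dist_le_half_dist_reflection`).

A geodesic satisfies `γ(m) γ(m-r)⁻¹ γ(m) = γ(m+r)` (`IsGeodesicOn.reflection`). Let `x` be the
geometric mean of `γ(m-r)` and `δ(m+r)`. Reflecting `γ(m-r)` gives `d(γ(m), x) ≤ d(γ(m+r), δ(m+r)) /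
2`, reflecting `δ(m+r)` gives `d(x, δ(m)) ≤ d(γ(m-r), δ(m-r)) / 2`. The triangle inequality yields
midpoint convexity, and a Lipschitz bound upgrades it to convexity. -/

open Filter Topology MeasureTheory

namespace PositiveCone

/-! ### Calculus of the inverse in a Banach algebra. -/

section Inverse

variable {R : Type*} [NormedRing R] [HasSummableGeomSeries R]

theorem HasDerivWithinAt.ringInverse [NormedAlgebra ℝ R] {f : ℝ → R} {f' : R} {s : Set ℝ} {t : ℝ}
    (hf : HasDerivWithinAt f f' s t) (hu : IsUnit (f t)) :
    HasDerivWithinAt (fun u => Ring.inverse (f u))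
      (-(Ring.inverse (f t) * f' * Ring.inverse (f t))) s t := by
  obtain ⟨u, hu⟩ := hu
  have h := hasFDerivAt_ringInverse (𝕜 := ℝ) u
  rw [hu] at h
  rw [← hu, Ring.inverse_unit]
  exact h.comp_hasDerivWithinAt t hf

theorem ContinuousWithinAt.ringInverse {X : Type*} [TopologicalSpace X] {f : X → R} {s : Set X}
    {t : X} (hf : ContinuousWithinAt f s t) (hu : IsUnit (f t)) :
    ContinuousWithinAt (fun u => Ring.inverse (f u)) s t := by
  obtain ⟨u, hu⟩ := hu
  have h := NormedRing.inverse_continuousAt u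
  rw [hu] at h
  exact ContinuousAt.comp_continuousWithinAt (g := Ring.inverse) h hf

end Inverse

/-! ### Sylvester operators and the derivative of the square root. -/

section CStar

variable {A : Type*} [CStarAlgebra A]

/-- The Sylvester operator `w ↦ a * w + w * b`. -/
noncomputable def sylvester (a b : A) : A →L[ℝ] A :=
  ContinuousLinearMap.mul ℝ A a + (ContinuousLinearMap.mul ℝ A).flip b

@[simp]
theorem sylvester_apply (a b w : A) : sylvester a b w = a * w + w * b := rfl

variable [PartialOrder A] [StarOrderedRing A]

/-- With `c = k - b`, the operator is `2k - sylvester c c`. The bounds `r ≤ b ≤ k` give `‖c‖ ≤ k -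
r`, so the subtracted term has norm below `2k`. -/
theorem isUnit_sylvester {b : A} (hb : b ∈ cone A) : IsUnit (sylvester b b) := by
  rcases subsingleton_or_nontrivial A with hA | hA
  · exact isUnit_of_subsingleton _
  obtain ⟨r, hr, hrb⟩ := (CFC.exists_pos_algebraMap_le_iff (IsSelfAdjoint.of_nonneg hb.1)).2
    fun x hx => IsStrictlyPositive.spectrum_pos (𝕜 := ℝ) hb hx
  set k : ℝ := ‖b‖ + r
  have hk : 0 < k := by positivity
  have hbk : b ≤ algebraMap ℝ A k :=
    (IsSelfAdjoint.of_nonneg hb.1).le_algebraMap_norm_self.trans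
      (algebraMap_mono A (by simp [k, hr.le]))
  set c : A := algebraMap ℝ A k - b
  have hc : ‖c‖ ≤ k - r := by
    rw [CStarAlgebra.norm_le_iff_le_algebraMap c (by simp [k]) (sub_nonneg.2 hbk)]
    rw [map_sub]
    exact sub_le_sub_left hrb _
  have hT : ‖sylvester c c‖ ≤ 2 * (k - r) := by
    refine ContinuousLinearMap.opNorm_le_bound _ (by simp [k]) fun w => ?_
    calc ‖c * w + w * c‖ ≤ ‖c‖ * ‖w‖ + ‖w‖ * ‖c‖ :=
          (norm_add_le _ _).trans (add_le_add (norm_mul_le _ _) (norm_mul_le _ _))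
      _ = 2 * ‖c‖ * ‖w‖ := by ring
      _ ≤ 2 * (k - r) * ‖w‖ := by gcongr
  have h := spectrum.mem_resolventSet_of_norm_lt_mul (𝕜 := ℝ) (a := sylvester c c) (k := 2 * k) (by
    calc ‖sylvester c c‖ * ‖(1 : A →L[ℝ] A)‖ ≤ 2 * (k - r) * 1 := by
          gcongr
          · simp [k]
          · exact ContinuousLinearMap.norm_id_le
      _ < ‖2 * k‖ := by rw [Real.norm_of_nonneg (by positivity)]; linarith)
  change IsUnit (algebraMap ℝ (A →L[ℝ] A) (2 * k) - sylvester c c) at h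
  convert h using 1
  ext w
  simp only [sylvester_apply, sub_apply, c, Algebra.algebraMap_eq_smul_one,
    smul_apply, sub_mul, mul_sub, smul_mul_assoc, mul_smul_comm, one_mul,
    mul_one, one_apply_eq_self]
  module

/-- For `β = √α`, one has `β(u)² - β(t)² = β(u)(β(u) - β(t)) + (β(u) - β(t))β(t)`, so a Sylvester
operator, invertible near `t`, carries slopes of `β` to slopes of `α`. Inverting it and passing to
the limit gives the derivative. -/
theorem hasDerivWithinAt_sqrt {α : ℝ → A} {v : A} {s : Set ℝ} {t : ℝ}
    (hα : ∀ u ∈ s, α u ∈ cone A) (ht : t ∈ s) (hv : HasDerivWithinAt α v s t) :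
    ∃ w, HasDerivWithinAt (fun u => CFC.sqrt (α u)) w s t ∧
      CFC.sqrt (α t) * w + w * CFC.sqrt (α t) = v := by
  set β : ℝ → A := fun u => CFC.sqrt (α u)
  have hβ (u) (hu : u ∈ s) : β u ∈ cone A := IsStrictlyPositive.sqrt (α u) (hα u hu)
  have hβα (u) (hu : u ∈ s) : β u * β u = α u := CFC.sqrt_mul_sqrt_self _ (hα u hu).1
  have hcont : ContinuousWithinAt β s t :=
    (CFC.continuousOn_sqrt (α t) (hα t ht).1).comp hv.continuousWithinAt fun u hu => (hα u hu).1
  set L : ℝ → A →L[ℝ] A := fun u => sylvester (β u) (β t)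
  have hL : ContinuousWithinAt L s t :=
    (((ContinuousLinearMap.mul ℝ A).continuous.continuousAt.comp_continuousWithinAt hcont).add
      continuousWithinAt_const)
  have hLt : IsUnit (L t) := isUnit_sylvester (hβ t ht)
  have hLi := ContinuousWithinAt.ringInverse hL hLt
  have hslope (u) (hu : u ∈ s) : slope α t u = L u (slope β t u) := by
    simp only [slope_def_module, map_smul, L, sylvester_apply, ← hβα u hu, ← hβα t ht]
    congr 1
    noncomm_ring
  refine ⟨Ring.inverse (L t) v, ?_, ?_⟩
  · rw [hasDerivWithinAt_iff_tendsto_slope] at hv ⊢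
    have h1 : Tendsto (fun u => Ring.inverse (L u) (slope α t u)) (𝓝[s \ {t}] t)
        (𝓝 (Ring.inverse (L t) v)) :=
      (isBoundedBilinearMap_apply.continuous.tendsto (Ring.inverse (L t), v)).comp
        (Tendsto.prodMk_nhds (hLi.mono sdiff_subset) hv)
    refine h1.congr' ?_
    have h2 : ∀ᶠ u in 𝓝[s \ {t}] t, IsUnit (L u) :=
      (hL.mono sdiff_subset).eventually (Units.isOpen.mem_nhds hLt)
    filter_upwards [h2, self_mem_nhdsWithin] with u hu hus
    rw [hslope u hus.1]
    exact congr($(Ring.inverse_mul_cancel _ hu) (slope β t u))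
  · exact congr($(Ring.mul_inverse_cancel _ hLt) v)

end CStar

/-! ### Trace inequalities and congruence invariance of the metric. -/

section Trace

variable {A : Type*} [CStarAlgebra A] {τ : A →ₗ[ℂ] ℂ}

theorem metric_smul (a x : A) (r : ℝ) : metric τ a (r • x) (r • x) = r ^ 2 * metric τ a x x := by
  simp only [metric, smul_mul_assoc, mul_smul_comm, LinearMap.map_smul_of_tower, Complex.smul_re,
    smul_eq_mul]
  ring

theorem sqrt_metric_smul (a x : A) {r : ℝ} (hr : 0 ≤ r) :
    √(metric τ a (r • x) (r • x)) = r * √(metric τ a x x) := by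
  rw [metric_smul, Real.sqrt_mul (sq_nonneg r), Real.sqrt_sq hr]

variable [PartialOrder A]

theorem metric_conj (hτ : IsFiniteNormalFaithfulTrace τ) {a g : A} (x : A) (ha : IsUnit a)
    (hg : IsUnit g) : metric τ (g * a * g) (g * x * g) (g * x * g) = metric τ a x x := by
  obtain ⟨u, rfl⟩ := ha
  obtain ⟨v, rfl⟩ := hg
  simp only [metric]
  rw [← Units.val_mul, ← Units.val_mul, Ring.inverse_unit, Ring.inverse_unit]
  simp only [mul_inv_rev, Units.val_mul, mul_assoc, Units.mul_inv_cancel_left,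
    Units.inv_mul_cancel_left]
  rw [hτ.tracial]
  simp only [mul_assoc, Units.inv_mul, mul_one]

variable [StarOrderedRing A]

open scoped ComplexOrder in
theorem IsFiniteNormalFaithfulTrace.continuous (hτ : IsFiniteNormalFaithfulTrace τ) :
    Continuous τ :=
  map_continuous (PositiveLinearMap.mk₀ τ fun x hx =>
    Complex.nonneg_iff.2 ⟨(hτ.nonneg x hx).1, (hτ.nonneg x hx).2.symm⟩)

/-- Positivity of `τ` on `star (x - star x) * (x - star x)`. -/
theorem IsFiniteNormalFaithfulTrace.re_mul_self_add_le (hτ : IsFiniteNormalFaithfulTrace τ)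
    (x : A) : (τ (x * x)).re + (τ (star x * star x)).re ≤ 2 * (τ (star x * x)).re := by
  have h := (hτ.nonneg _ (star_mul_self_nonneg (x - star x))).1
  have e : star (x - star x) * (x - star x)
      = star x * x + x * star x - x * x - star x * star x := by
    rw [star_sub, star_star]
    noncomm_ring
  rw [e, map_sub, map_sub, map_add, hτ.tracial x (star x)] at h
  simp only [Complex.sub_re, Complex.add_re] at h
  linarith

/-- Put `x = w b⁻¹`. By cyclicity the right side is `2 τ(x x) + 2 τ(x* x)` and the left side is `4
τ(x x)`, in real parts. -/
theorem four_mul_metric_le (hτ : IsFiniteNormalFaithfulTrace τ) {b w : A} (hb : b ∈ cone A)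
    (hw : IsSelfAdjoint w) :
    4 * metric τ b w w ≤ metric τ (b * b) (b * w + w * b) (b * w + w * b) := by
  obtain ⟨hb0, u, rfl⟩ := hb
  have hc : IsSelfAdjoint (↑u⁻¹ : A) := by
    have := (IsSelfAdjoint.of_nonneg hb0).ringInverse
    rwa [Ring.inverse_unit] at this
  have h := hτ.re_mul_self_add_le (w * ↑u⁻¹)
  rw [star_mul, hc.star_eq, hw.star_eq] at h
  have e : (↑u * w + w * ↑u) * ↑(u * u)⁻¹ * (↑u * w + w * ↑u) * ↑(u * u)⁻¹
      = ↑u * (w * ↑u⁻¹ * w * ↑u⁻¹ * ↑u⁻¹) + ↑u * (w * ↑u⁻¹ * ↑u⁻¹ * w * ↑u⁻¹)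
        + w * w * ↑u⁻¹ * ↑u⁻¹ + w * ↑u⁻¹ * w * ↑u⁻¹ := by
    simp only [mul_inv_rev, Units.val_mul, add_mul, mul_add, mul_assoc, Units.inv_mul_cancel_left,
      Units.mul_inv_cancel_left]
    abel
  have e1 : τ (↑u * (w * ↑u⁻¹ * w * ↑u⁻¹ * ↑u⁻¹)) = τ (w * ↑u⁻¹ * (w * ↑u⁻¹)) := by
    rw [hτ.tracial]
    simp [mul_assoc]
  have e2 : τ (↑u * (w * ↑u⁻¹ * ↑u⁻¹ * w * ↑u⁻¹)) = τ (↑u⁻¹ * w * (w * ↑u⁻¹)) := by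
    rw [hτ.tracial]
    simpa [mul_assoc] using hτ.tracial (w * ↑u⁻¹) (↑u⁻¹ * w)
  have e3 : τ (w * w * ↑u⁻¹ * ↑u⁻¹) = τ (↑u⁻¹ * w * (w * ↑u⁻¹)) := by
    rw [hτ.tracial]
    simp only [mul_assoc]
  have e4 : τ (↑u⁻¹ * w * (↑u⁻¹ * w)) = τ (w * ↑u⁻¹ * (w * ↑u⁻¹)) := by
    rw [mul_assoc, hτ.tracial]
    simp only [mul_assoc]
  have e5 : w * ↑u⁻¹ * w * ↑u⁻¹ = w * ↑u⁻¹ * (w * (↑u⁻¹ : A)) := by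
    simp only [mul_assoc]
  simp only [metric]
  rw [← Units.val_mul, Ring.inverse_unit, Ring.inverse_unit, e]
  simp only [map_add, Complex.add_re]
  rw [e1, e2, e3, e5]
  rw [e4] at h
  linarith

theorem conj_mem_cone {a g : A} (ha : a ∈ cone A) (hg : g ∈ cone A) : g * a * g ∈ cone A :=
  ⟨(IsSelfAdjoint.of_nonneg hg.1).conjugate_nonneg ha.1, (hg.2.mul ha.2).mul hg.2⟩

theorem add_smul_mem_cone {a b : A} (ha : a ∈ cone A) (hb : b ∈ cone A) {t : ℝ}
    (ht : t ∈ Icc (0 : ℝ) 1) : a + t • (b - a) ∈ cone A := by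
  have e : a + t • (b - a) = (1 - t) • a + t • b := by module
  rw [e]
  rcases ht.2.eq_or_lt with rfl | h
  · simpa using hb
  · exact IsStrictlyPositive.add_nonneg (IsStrictlyPositive.smul (sub_pos.2 h) ha)
      (smul_nonneg ht.1 hb.1)

end Trace

/-! ### Lengths, and maps that contract the distance. -/

section Length

variable {A : Type*} [CStarAlgebra A] {τ : A →ₗ[ℂ] ℂ}

theorem speed_eq {γ : ℝ → A} {v : A} {t : ℝ} (ht : t ∈ Icc (0 : ℝ) 1)
    (hv : HasDerivWithinAt γ v (Icc 0 1) t) : speed τ γ t = √(metric τ (γ t) v v) := by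
  rw [speed, hv.derivWithin (uniqueDiffOn_Icc_zero_one t ht)]

theorem speed_nonneg (γ : ℝ → A) (t : ℝ) : 0 ≤ speed τ γ t := Real.sqrt_nonneg _

theorem length_nonneg (γ : ℝ → A) : 0 ≤ length τ γ :=
  intervalIntegral.integral_nonneg zero_le_one fun t _ => speed_nonneg γ t

variable [PartialOrder A]

theorem dist_le_length {γ : ℝ → A} {a b : A} (h : IsCurveJoining τ γ a b) :
    dist τ a b ≤ length τ γ :=
  csInf_le ⟨0, by rintro _ ⟨γ, -, rfl⟩; exact length_nonneg γ⟩ ⟨γ, h, rfl⟩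

theorem continuousOn_inverse_comp {γ : ℝ → A} {s : Set ℝ} (hmem : ∀ t ∈ s, γ t ∈ cone A)
    (hγ : ContinuousOn γ s) : ContinuousOn (fun t => Ring.inverse (γ t)) s := fun t ht =>
  ContinuousWithinAt.ringInverse (hγ t ht) (hmem t ht).2

variable [StarOrderedRing A]

/-- The velocity need not be continuous, but derivatives are measurable; the one-sided values at the
end points form a null set. -/
theorem aestronglyMeasurable_speed (hτ : IsFiniteNormalFaithfulTrace τ) {γ : ℝ → A}
    (hmem : ∀ t ∈ Icc (0 : ℝ) 1, γ t ∈ cone A) (hγ : DifferentiableOn ℝ γ (Icc 0 1)) :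
    AEStronglyMeasurable (speed τ γ) (volume.restrict (Icc 0 1)) := by
  have hi : AEStronglyMeasurable (fun t => Ring.inverse (γ t)) (volume.restrict (Icc 0 1)) :=
    (continuousOn_inverse_comp hmem hγ.continuousOn).aestronglyMeasurable_of_isCompact
      isCompact_Icc measurableSet_Icc
  have hd : AEStronglyMeasurable (derivWithin γ (Icc 0 1)) (volume.restrict (Icc 0 1)) := by
    refine (aestronglyMeasurable_deriv γ _).congr ?_
    rw [Filter.EventuallyEq, ← restrict_Ioo_eq_restrict_Icc]
    filter_upwards [ae_restrict_mem measurableSet_Ioo] with t ht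
    exact (derivWithin_of_mem_nhds (Icc_mem_nhds ht.1 ht.2)).symm
  exact Real.continuous_sqrt.comp_aestronglyMeasurable
    (Complex.continuous_re.comp_aestronglyMeasurable
      (hτ.continuous.comp_aestronglyMeasurable (((hd.mul hi).mul hd).mul hi)))

theorem IsCurveJoining.of_speed_le (hτ : IsFiniteNormalFaithfulTrace τ) {γ : ℝ → A} {f : ℝ → ℝ}
    (hmem : ∀ t ∈ Icc (0 : ℝ) 1, γ t ∈ cone A) (hγ : DifferentiableOn ℝ γ (Icc 0 1))
    (hf : IntervalIntegrable f volume 0 1) (h : ∀ t ∈ Icc (0 : ℝ) 1, speed τ γ t ≤ f t) :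
    IsCurveJoining τ γ (γ 0) (γ 1) where
  mem_cone := hmem
  differentiable := hγ
  rectifiable := by
    rw [intervalIntegrable_iff_integrableOn_Icc_of_le zero_le_one] at hf ⊢
    refine Integrable.mono' hf (aestronglyMeasurable_speed hτ hmem hγ) ?_
    filter_upwards [ae_restrict_mem measurableSet_Icc] with t ht
    rw [Real.norm_of_nonneg (speed_nonneg γ t)]
    exact h t ht
  source := rfl
  target := rfl

theorem dist_le_integral (hτ : IsFiniteNormalFaithfulTrace τ) {γ : ℝ → A} {f : ℝ → ℝ}
    (hmem : ∀ t ∈ Icc (0 : ℝ) 1, γ t ∈ cone A) (hγ : DifferentiableOn ℝ γ (Icc 0 1))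
    (hf : IntervalIntegrable f volume 0 1) (h : ∀ t ∈ Icc (0 : ℝ) 1, speed τ γ t ≤ f t) :
    dist τ (γ 0) (γ 1) ≤ ∫ t in (0 : ℝ)..1, f t := by
  have hc := IsCurveJoining.of_speed_le hτ hmem hγ hf h
  exact (dist_le_length hc).trans
    (intervalIntegral.integral_mono_on zero_le_one hc.rectifiable hf h)

theorem exists_isCurveJoining (hτ : IsFiniteNormalFaithfulTrace τ) {a b : A} (ha : a ∈ cone A)
    (hb : b ∈ cone A) : ∃ γ, IsCurveJoining τ γ a b := by
  set γ : ℝ → A := fun t => a + t • (b - a)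
  have hmem (t) (ht : t ∈ Icc (0 : ℝ) 1) : γ t ∈ cone A := add_smul_mem_cone ha hb ht
  have hd (t : ℝ) : HasDerivAt γ (b - a) t := by
    have h := ((hasDerivAt_id t).smul_const (b - a)).const_add a
    rwa [one_smul] at h
  have hγ : DifferentiableOn ℝ γ (Icc 0 1) := fun t _ =>
    (hd t).differentiableAt.differentiableWithinAt
  have hi := continuousOn_inverse_comp hmem hγ.continuousOn
  have hcont : ContinuousOn (fun t => √(metric τ (γ t) (b - a) (b - a))) (Icc 0 1) :=
    (Complex.continuous_re.comp_continuousOn (hτ.continuous.comp_continuousOn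
      (((continuousOn_const.mul hi).mul continuousOn_const).mul hi))).sqrt
  have h := IsCurveJoining.of_speed_le hτ hmem hγ
    (hcont.intervalIntegrable_of_Icc zero_le_one)
    fun t ht => (speed_eq ht (hd t).hasDerivWithinAt).le
  exact ⟨γ, by simpa [γ] using h⟩

theorem le_mul_dist (hτ : IsFiniteNormalFaithfulTrace τ) {a b : A} (ha : a ∈ cone A)
    (hb : b ∈ cone A) {c d : ℝ} (hc : 0 < c)
    (h : ∀ γ, IsCurveJoining τ γ a b → d ≤ c * length τ γ) : d ≤ c * dist τ a b := by
  -- The real `sInf` of the empty set is 0, so a lower bound needs at least one joining curve.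
  obtain ⟨γ, hγ⟩ := exists_isCurveJoining hτ ha hb
  rw [← div_le_iff₀' hc]
  refine le_csInf ⟨_, γ, hγ, rfl⟩ ?_
  rintro _ ⟨γ, hγ, rfl⟩
  exact (div_le_iff₀' hc).2 (h γ hγ)

theorem dist_sqrt_le (hτ : IsFiniteNormalFaithfulTrace τ) {a b : A} (ha : a ∈ cone A)
    (hb : b ∈ cone A) : dist τ (CFC.sqrt a) (CFC.sqrt b) ≤ 1 / 2 * dist τ a b := by
  refine le_mul_dist hτ ha hb one_half_pos fun α hα => ?_
  have hd (t) (ht : t ∈ Icc (0 : ℝ) 1) :=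
    hasDerivWithinAt_sqrt hα.mem_cone ht (hα.differentiable t ht).hasDerivWithinAt
  have hmem (t) (ht : t ∈ Icc (0 : ℝ) 1) : CFC.sqrt (α t) ∈ cone A :=
    IsStrictlyPositive.sqrt (α t) (hα.mem_cone t ht)
  have h := dist_le_integral hτ (γ := fun t => CFC.sqrt (α t)) hmem
    (fun t ht => (hd t ht).choose_spec.1.differentiableWithinAt)
    (hα.rectifiable.const_mul (1 / 2)) ?_
  · rwa [hα.source, hα.target, intervalIntegral.integral_const_mul] at h
  intro t ht
  obtain ⟨w, hw, hwv⟩ := hd t ht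
  -- `w` and `star w` are both derivatives of the same selfadjoint curve.
  have hsa : IsSelfAdjoint w := by
    refine (uniqueDiffOn_Icc_zero_one t ht).eq_deriv _ ?_ hw
    refine hw.star.congr (fun u _ => ?_) ?_
    all_goals exact (IsSelfAdjoint.of_nonneg (CFC.sqrt_nonneg _)).star_eq.symm
  have hm := four_mul_metric_le hτ (hmem t ht) hsa
  rw [hwv, CFC.sqrt_mul_sqrt_self _ (hα.mem_cone t ht).1] at hm
  rw [speed_eq ht hw, speed]
  refine Real.sqrt_le_iff.2 ⟨by positivity, ?_⟩
  -- If the metric value is nonpositive, its `Real.sqrt` is 0 and the inequality still holds.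
  rcases le_total 0 (metric τ (α t) (derivWithin α (Icc 0 1) t) (derivWithin α (Icc 0 1) t))
    with h0 | h0
  · rw [mul_pow, Real.sq_sqrt h0]
    linarith
  · rw [Real.sqrt_eq_zero_of_nonpos h0]
    linarith

theorem dist_conj_le (hτ : IsFiniteNormalFaithfulTrace τ) {a b g : A} (ha : a ∈ cone A)
    (hb : b ∈ cone A) (hg : g ∈ cone A) :
    dist τ (g * a * g) (g * b * g) ≤ dist τ a b := by
  rw [← one_mul (dist τ a b)]
  refine le_mul_dist hτ ha hb one_pos fun α hα => ?_
  have hd (t) (ht : t ∈ Icc (0 : ℝ) 1) :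
      HasDerivWithinAt (fun t => g * α t * g) (g * derivWithin α (Icc 0 1) t * g) (Icc 0 1) t :=
    ((hα.differentiable t ht).hasDerivWithinAt.const_mul g).mul_const g
  have h := dist_le_integral hτ (γ := fun t => g * α t * g)
    (fun t ht => conj_mem_cone (hα.mem_cone t ht) hg)
    (fun t ht => (hd t ht).differentiableWithinAt) hα.rectifiable fun t ht => by
      rw [speed_eq ht (hd t ht), metric_conj hτ _ (hα.mem_cone t ht).2 hg.2, speed]
  rwa [hα.source, hα.target, ← length, ← one_mul (length τ α)] at h

end Length

/-- Supplies differentiable time changes that come to rest, for joining curves. -/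
theorem hasDerivAt_max_zero_sq (x : ℝ) :
    HasDerivAt (fun u : ℝ => max 0 u ^ 2) (2 * max 0 x) x := by
  rcases lt_trichotomy x 0 with h | rfl | h
  · rw [max_eq_left h.le, mul_zero]
    refine (hasDerivAt_const x (0 : ℝ)).congr_of_eventuallyEq ?_
    filter_upwards [Iio_mem_nhds h] with u hu
    rw [max_eq_left (le_of_lt hu)]
    simp
  · have h : (fun u : ℝ => max 0 u ^ 2) =O[𝓝 0] fun u => ‖u - 0‖ ^ 2 := by
      refine Asymptotics.IsBigO.of_bound 1 (Eventually.of_forall fun u => ?_)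
      simp only [norm_pow, norm_norm, sub_zero, one_mul]
      refine pow_le_pow_left₀ (norm_nonneg _) ?_ 2
      rcases le_total u 0 with hu | hu <;> simp [hu]
    simpa using (h.hasFDerivAt one_lt_two).hasDerivAt
  · rw [max_eq_right h.le]
    have h2 := hasDerivAt_pow 2 x
    simp only [Nat.cast_ofNat, Nat.add_one_sub_one, pow_one] at h2
    refine h2.congr_of_eventuallyEq ?_
    filter_upwards [Ioi_mem_nhds h] with u hu
    rw [max_eq_right (le_of_lt hu)]

/-! ### The triangle inequality, reflections and geometric means. -/

section Triangle

variable {A : Type*} [CStarAlgebra A] [PartialOrder A] {τ : A →ₗ[ℂ] ℂ}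

theorem IsCurveJoining.reparametrize {α : ℝ → A} {a b : A} (hα : IsCurveJoining τ α a b)
    {φ φ' : ℝ → ℝ} (hφ : ∀ t, HasDerivAt φ (φ' t) t) (hφ' : ∀ t, 0 ≤ φ' t) (h0 : φ 0 = 0)
    (h1 : φ 1 = 1) :
    IntervalIntegrable (fun t => φ' t * speed τ α (φ t)) volume 0 1 ∧
      ∫ t in (0 : ℝ)..1, φ' t * speed τ α (φ t) = length τ α := by
  have hc : ContinuousOn φ (Icc 0 1) := fun t _ => (hφ t).continuousAt.continuousWithinAt
  constructor
  · rw [intervalIntegrable_iff_integrableOn_Icc_of_le zero_le_one]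
    refine (integrableOn_Icc_deriv_smul_iff_of_deriv_nonneg hc (fun t _ => hφ t)
      (fun t _ => hφ' t) zero_le_one).2 ?_
    rw [h0, h1]
    exact (intervalIntegrable_iff_integrableOn_Icc_of_le zero_le_one).1 hα.rectifiable
  · have h := integral_Icc_deriv_smul_of_deriv_nonneg (g := speed τ α) hc (fun t _ => hφ t)
      (fun t _ => hφ' t) zero_le_one
    rw [h0, h1] at h
    rw [length, intervalIntegral.integral_of_le zero_le_one,
      intervalIntegral.integral_of_le zero_le_one, ← integral_Icc_eq_integral_Ioc,
      ← integral_Icc_eq_integral_Ioc]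
    exact h

variable [StarOrderedRing A]

theorem dist_le_length_add_length (hτ : IsFiniteNormalFaithfulTrace τ) {α β : ℝ → A} {a b c : A}
    (hα : IsCurveJoining τ α a b) (hβ : IsCurveJoining τ β b c) :
    dist τ a c ≤ length τ α + length τ β := by
  -- Curves must be differentiable everywhere, so a concatenation may not have a corner: `φ` runs
  -- through `α` before time 1/2 and `ψ` through `β` after it, both at rest at 1/2.
  set φ : ℝ → ℝ := fun t => 1 - max 0 (1 - 2 * t) ^ 2
  set φ' : ℝ → ℝ := fun t => 4 * max 0 (1 - 2 * t)
  set ψ : ℝ → ℝ := fun t => max 0 (2 * t - 1) ^ 2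
  set ψ' : ℝ → ℝ := fun t => 4 * max 0 (2 * t - 1)
  have hφ (t : ℝ) : HasDerivAt φ (φ' t) t := by
    have h := ((hasDerivAt_max_zero_sq (1 - 2 * t)).comp t
      (((hasDerivAt_id t).const_mul 2).const_sub 1)).const_sub 1
    refine h.congr_deriv ?_
    change _ = 4 * max 0 (1 - 2 * t)
    ring
  have hψ (t : ℝ) : HasDerivAt ψ (ψ' t) t := by
    have h := (hasDerivAt_max_zero_sq (2 * t - 1)).comp t
      (((hasDerivAt_id t).const_mul 2).sub_const 1)
    refine h.congr_deriv ?_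
    change _ = 4 * max 0 (2 * t - 1)
    ring
  have hφ0 (t) : 0 ≤ φ' t := by positivity
  have hψ0 (t) : 0 ≤ ψ' t := by positivity
  obtain ⟨hαi, hαl⟩ := hα.reparametrize hφ hφ0 (by norm_num [φ]) (by norm_num [φ])
  obtain ⟨hβi, hβl⟩ := hβ.reparametrize hψ hψ0 (by norm_num [ψ]) (by norm_num [ψ])
  have hφI (t) (ht : t ∈ Icc (0 : ℝ) 1) : φ t ∈ Icc (0 : ℝ) 1 := by
    have h1 : max 0 (1 - 2 * t) ≤ 1 := max_le zero_le_one (by linarith [ht.1])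
    have h2 := pow_le_one₀ (n := 2) (le_max_left 0 (1 - 2 * t)) h1
    exact ⟨sub_nonneg.2 h2, sub_le_self _ (sq_nonneg _)⟩
  have hψI (t) (ht : t ∈ Icc (0 : ℝ) 1) : ψ t ∈ Icc (0 : ℝ) 1 := by
    have h1 : max 0 (2 * t - 1) ≤ 1 := max_le zero_le_one (by linarith [ht.2])
    exact ⟨sq_nonneg _, pow_le_one₀ (le_max_left 0 (2 * t - 1)) h1⟩
  -- One summand is constant on each half, so differentiability needs no gluing.
  set γ : ℝ → A := fun t => α (φ t) + (β (ψ t) - b)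
  have hd (t) (ht : t ∈ Icc (0 : ℝ) 1) : HasDerivWithinAt γ
      (φ' t • derivWithin α (Icc 0 1) (φ t) + ψ' t • derivWithin β (Icc 0 1) (ψ t))
      (Icc 0 1) t :=
    ((hα.differentiable _ (hφI t ht)).hasDerivWithinAt.scomp t (hφ t).hasDerivWithinAt hφI).add
      (((hβ.differentiable _ (hψI t ht)).hasDerivWithinAt.scomp t (hψ t).hasDerivWithinAt
        hψI).sub_const b)
  have hleft (t : ℝ) (ht : t ≤ 1 / 2) : ψ t = 0 ∧ ψ' t = 0 := by
    simp [ψ, ψ', max_eq_left (show 2 * t - 1 ≤ 0 by linarith)]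
  have hright (t : ℝ) (ht : 1 / 2 ≤ t) : φ t = 1 ∧ φ' t = 0 := by
    simp [φ, φ', max_eq_left (show 1 - 2 * t ≤ 0 by linarith)]
  have hγl (t : ℝ) (ht : t ≤ 1 / 2) : γ t = α (φ t) := by
    simp [γ, (hleft t ht).1, hβ.source]
  have hγr (t : ℝ) (ht : 1 / 2 ≤ t) : γ t = β (ψ t) := by
    simp [γ, (hright t ht).1, hα.target]
  have hmem (t) (ht : t ∈ Icc (0 : ℝ) 1) : γ t ∈ cone A := by
    rcases le_total t (1 / 2) with h | h
    · rw [hγl t h]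
      exact hα.mem_cone _ (hφI t ht)
    · rw [hγr t h]
      exact hβ.mem_cone _ (hψI t ht)
  have h := dist_le_integral hτ hmem (fun t ht => (hd t ht).differentiableWithinAt)
    (hαi.add hβi) fun t ht => by
      rw [speed_eq ht (hd t ht)]
      rcases le_total t (1 / 2) with h | h
      · rw [hγl t h, (hleft t h).2, zero_smul, add_zero, sqrt_metric_smul _ _ (hφ0 t)]
        simp [speed]
      · rw [hγr t h, (hright t h).2, zero_smul, zero_add, sqrt_metric_smul _ _ (hψ0 t)]
        simp [speed]
  rw [intervalIntegral.integral_add hαi hβi, hαl, hβl] at h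
  have e0 : γ 0 = a := by
    rw [hγl 0 (by norm_num)]
    simp [φ, hα.source]
  have e1 : γ 1 = c := by
    rw [hγr 1 (by norm_num)]
    norm_num [ψ, hβ.target]
  rwa [e0, e1] at h

theorem dist_triangle (hτ : IsFiniteNormalFaithfulTrace τ) {a b c : A} (ha : a ∈ cone A)
    (hb : b ∈ cone A) (hc : c ∈ cone A) : dist τ a c ≤ dist τ a b + dist τ b c := by
  rw [← sub_le_iff_le_add', ← one_mul (dist τ b c)]
  refine le_mul_dist hτ hb hc one_pos fun β hβ => ?_
  rw [one_mul, sub_le_comm, ← one_mul (dist τ a b)]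
  refine le_mul_dist hτ ha hb one_pos fun α hα => ?_
  linarith [dist_le_length_add_length hτ hα hβ]

theorem inverse_mem_cone {a : A} (ha : a ∈ cone A) : Ring.inverse a ∈ cone A :=
  IsStrictlyPositive.ringInverse ha

theorem exists_sqrt_mem_cone {a : A} (ha : a ∈ cone A) : ∃ s ∈ cone A, s * s = a :=
  ⟨CFC.sqrt a, IsStrictlyPositive.sqrt a ha, CFC.sqrt_mul_sqrt_self _ ha.1⟩

theorem dist_le_half_dist_mul_self (hτ : IsFiniteNormalFaithfulTrace τ) {x y : A}
    (hx : x ∈ cone A) (hy : y ∈ cone A) : dist τ x y ≤ 1 / 2 * dist τ (x * x) (y * y) := by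
  have hm {z : A} (hz : z ∈ cone A) : z * z ∈ cone A :=
    ⟨by simpa [(IsSelfAdjoint.of_nonneg hz.1).star_eq] using star_mul_self_nonneg z,
      hz.2.mul hz.2⟩
  simpa only [CFC.sqrt_mul_self _ hx.1, CFC.sqrt_mul_self _ hy.1] using
    dist_sqrt_le hτ (hm hx) (hm hy)

/-- Congruence by `s⁻¹`, where `s² = a`, moves `a` to 1 and turns the reflection into squaring:
`(s⁻¹ x s⁻¹)² = s⁻¹ (x a⁻¹ x) s⁻¹`. -/
theorem dist_le_half_dist_reflection (hτ : IsFiniteNormalFaithfulTrace τ) {x y a : A}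
    (hx : x ∈ cone A) (hy : y ∈ cone A) (ha : a ∈ cone A) :
    dist τ x y ≤ 1 / 2 * dist τ (x * Ring.inverse a * x) (y * Ring.inverse a * y) := by
  obtain ⟨s, hs, rfl⟩ := exists_sqrt_mem_cone ha
  obtain ⟨u, rfl⟩ := hs.2
  have hi := inverse_mem_cone hs
  rw [Ring.inverse_unit] at hi
  rw [← Units.val_mul, Ring.inverse_unit]
  have hmem {z : A} (hz : z ∈ cone A) : z * ↑(u * u)⁻¹ * z ∈ cone A := by
    have h := conj_mem_cone (inverse_mem_cone ha) hz
    rwa [← Units.val_mul, Ring.inverse_unit] at h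
  have h1 := dist_conj_le hτ (conj_mem_cone hx hi) (conj_mem_cone hy hi) hs
  have h2 := dist_le_half_dist_mul_self hτ (conj_mem_cone hx hi) (conj_mem_cone hy hi)
  have h3 := dist_conj_le hτ (hmem hx) (hmem hy) hi
  simp only [mul_inv_rev, Units.val_mul, mul_assoc, Units.mul_inv_cancel_left, Units.inv_mul,
    mul_one] at h1 h2 h3 ⊢
  linarith

/-- The geometric mean of `a` and `b`. -/
theorem exists_geometric_mean {a b : A} (ha : a ∈ cone A) (hb : b ∈ cone A) :
    ∃ x ∈ cone A, x * Ring.inverse a * x = b ∧ x * Ring.inverse b * x = a := by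
  obtain ⟨s, hs, rfl⟩ := exists_sqrt_mem_cone ha
  have hi := inverse_mem_cone hs
  -- The witness is `a^(1/2) (a^(-1/2) b a^(-1/2))^(1/2) a^(1/2)`.
  obtain ⟨r, hr, hrb⟩ := exists_sqrt_mem_cone (conj_mem_cone hb hi)
  have hx := conj_mem_cone hr hs
  refine ⟨s * r * s, hx, ?_⟩
  have h : s * r * s * Ring.inverse (s * s) * (s * r * s) = b := by
    obtain ⟨u, rfl⟩ := hs.2
    rw [← Units.val_mul, Ring.inverse_unit]
    rw [Ring.inverse_unit] at hrb
    have e : (↑u * r * ↑u * ↑(u * u)⁻¹ * (↑u * r * ↑u) : A) = ↑u * (r * r) * ↑u := by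
      simp only [mul_inv_rev, Units.val_mul, mul_assoc, Units.mul_inv_cancel_left,
        Units.inv_mul_cancel_left]
    rw [e, hrb]
    simp [mul_assoc]
  refine ⟨h, ?_⟩
  obtain ⟨v, hv⟩ := hx.2
  obtain ⟨w, hw⟩ := ha.2
  rw [← hv, ← hw, Ring.inverse_unit] at h
  rw [← hv, ← hw, ← h, ← Units.val_mul, ← Units.val_mul, Ring.inverse_unit]
  simp [mul_assoc]

end Triangle

theorem eqOn_const_of_hasDerivWithinAt_zero {E : Type*} [NormedAddCommGroup E] [NormedSpace ℝ E]
    {f : ℝ → E} {s : Set ℝ} (hs : Convex ℝ s) (hf : ∀ t ∈ s, HasDerivWithinAt f 0 s t) {x y : ℝ}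
    (hx : x ∈ s) (hy : y ∈ s) : f x = f y := by
  have h := hs.norm_image_sub_le_of_norm_hasDerivWithin_le (C := 0) hf (by simp) hy hx
  simpa [sub_eq_zero] using h

/-! ### Symmetry and Lipschitz continuity of geodesics. -/

section Geodesic

variable {A : Type*} [CStarAlgebra A] [PartialOrder A] {I : Set ℝ} {γ : ℝ → A}

/-- Euler's equation says exactly that `γ⁻¹ γ'` and `γ' γ⁻¹` have zero derivative; `v` is the
velocity at `m`. -/
theorem IsGeodesicOn.exists_generator (hI : Convex ℝ I) (hI' : (interior I).Nonempty)
    (hγ : IsGeodesicOn I γ) (m : ℝ) (hm : m ∈ I) :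
    ∃ v : A, ∀ t ∈ I, HasDerivWithinAt γ (γ t * Ring.inverse (γ m) * v) I t ∧
      HasDerivWithinAt γ (v * Ring.inverse (γ m) * γ t) I t := by
  have hU := uniqueDiffOn_convex hI hI'
  set D := derivWithin γ I
  have hD (t) (ht : t ∈ I) : HasDerivWithinAt γ (D t) I t :=
    (hγ.differentiable t ht).hasDerivWithinAt
  have hDD (t) (ht : t ∈ I) : HasDerivWithinAt D (D t * Ring.inverse (γ t) * D t) I t := by
    have h := hγ.euler t ht
    rw [covariantDeriv, sub_eq_zero, ← two_smul ℝ, smul_smul] at h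
    norm_num at h
    rw [← h]
    exact (hγ.differentiable_deriv t ht).hasDerivWithinAt
  have hinv (t) (ht : t ∈ I) :=
    HasDerivWithinAt.ringInverse (hD t ht) (hγ.mem_cone t ht).2
  refine ⟨D m, fun t ht => ?_⟩
  have hl : Ring.inverse (γ t) * D t = Ring.inverse (γ m) * D m :=
    eqOn_const_of_hasDerivWithinAt_zero (f := fun u => Ring.inverse (γ u) * D u) hI
      (fun u hu => ((hinv u hu).mul (hDD u hu)).congr_deriv (by noncomm_ring)) ht hm
  have hr : D t * Ring.inverse (γ t) = D m * Ring.inverse (γ m) :=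
    eqOn_const_of_hasDerivWithinAt_zero (f := fun u => D u * Ring.inverse (γ u)) hI
      (fun u hu => ((hDD u hu).mul (hinv u hu)).congr_deriv (by noncomm_ring)) ht hm
  have hu := (hγ.mem_cone t ht).2
  rw [mul_assoc, ← hl, ← hr, Ring.mul_inverse_cancel_left _ _ hu,
    Ring.inverse_mul_cancel_right _ _ hu]
  exact ⟨hD t ht, hD t ht⟩

/-- The product `γ(m+h) γ(m)⁻¹ γ(m-h)` is constant in `h`: the right form of the generator on the
first factor cancels the left form on the last. Its value at 0 is `γ(m)`. -/
theorem IsGeodesicOn.reflection (hI : Convex ℝ I) (hγ : IsGeodesicOn I γ) {m r : ℝ} (hr : 0 < r)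
    (hl : m - r ∈ I) (hu : m + r ∈ I) :
    γ m * Ring.inverse (γ (m - r)) * γ m = γ (m + r) ∧
      γ m * Ring.inverse (γ (m + r)) * γ m = γ (m - r) := by
  have hsub : Icc (m - r) (m + r) ⊆ I := hI.ordConnected.out hl hu
  have hm : m ∈ I := hsub ⟨by linarith, by linarith⟩
  have hI' : (interior I).Nonempty := by
    refine ⟨m, mem_interior_iff_mem_nhds.2 (mem_of_superset (Icc_mem_nhds ?_ ?_) hsub)⟩ <;>
    linarith
  obtain ⟨v, hv⟩ := hγ.exists_generator hI hI' m hm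
  have hp (h : ℝ) (hh : h ∈ Icc (-r) r) : m + h ∈ I := hsub ⟨by linarith [hh.1], by linarith [hh.2]⟩
  have hn (h : ℝ) (hh : h ∈ Icc (-r) r) : m - h ∈ I := hsub ⟨by linarith [hh.2], by linarith [hh.1]⟩
  have hf (h : ℝ) (hh : h ∈ Icc (-r) r) :
      HasDerivWithinAt (fun h => γ (m + h) * Ring.inverse (γ m) * γ (m - h)) 0 (Icc (-r) r) h := by
    have h1 : HasDerivWithinAt (fun h => γ (m + h)) (γ (m + h) * Ring.inverse (γ m) * v)
        (Icc (-r) r) h := by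
      have e := (hv _ (hp h hh)).1.scomp h ((hasDerivAt_id h).const_add m).hasDerivWithinAt hp
      rwa [one_smul] at e
    have h2 : HasDerivWithinAt (fun h => γ (m - h)) (-(v * Ring.inverse (γ m) * γ (m - h)))
        (Icc (-r) r) h := by
      have e := (hv _ (hn h hh)).2.scomp h ((hasDerivAt_id h).const_sub m).hasDerivWithinAt hn
      rwa [neg_smul, one_smul] at e
    exact ((h1.mul_const (Ring.inverse (γ m))).mul h2).congr_deriv (by noncomm_ring)
  have key (h : ℝ) (hh : h ∈ Icc (-r) r) :
      γ (m + h) * Ring.inverse (γ m) * γ (m - h) = γ m := by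
    have e := eqOn_const_of_hasDerivWithinAt_zero (convex_Icc (-r) r) hf hh
      (show (0 : ℝ) ∈ Icc (-r) r from ⟨by linarith, hr.le⟩)
    simpa [Ring.mul_inverse_cancel _ (hγ.mem_cone m hm).2] using e
  have k1 := key r ⟨by linarith, le_rfl⟩
  have k2 := key (-r) ⟨le_rfl, by linarith⟩
  rw [← sub_eq_add_neg, sub_neg_eq_add] at k2
  have hum := (hγ.mem_cone m hm).2
  have hul := (hγ.mem_cone _ hl).2
  have huu := (hγ.mem_cone _ hu).2
  constructor
  · nth_rewrite 1 [← k1]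
    rw [Ring.mul_inverse_cancel_right _ _ hul, Ring.inverse_mul_cancel_right _ _ hum]
  · nth_rewrite 1 [← k2]
    rw [Ring.mul_inverse_cancel_right _ _ huu, Ring.inverse_mul_cancel_right _ _ hum]

variable [StarOrderedRing A] {τ : A →ₗ[ℂ] ℂ}

/-- With `γ' = γ c` for a constant `c`, the squared speed reduces to the constant `τ(c c)` by
cyclicity. -/
theorem IsGeodesicOn.exists_dist_le (hτ : IsFiniteNormalFaithfulTrace τ) (hI : Convex ℝ I)
    (hI' : (interior I).Nonempty) (hγ : IsGeodesicOn I γ) :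
    ∃ K : ℝ, ∀ s ∈ I, ∀ t ∈ I, dist τ (γ s) (γ t) ≤ K * |t - s| := by
  obtain ⟨m, hm⟩ := hI'.mono interior_subset
  obtain ⟨v, hv⟩ := hγ.exists_generator hI hI' m hm
  set c := Ring.inverse (γ m) * v
  refine ⟨√(τ (c * c)).re, fun s hs t ht => ?_⟩
  have hmaps (u) (hu : u ∈ Icc (0 : ℝ) 1) : s + u * (t - s) ∈ I := hI.add_smul_sub_mem hs ht hu
  have hd (u) (hu : u ∈ Icc (0 : ℝ) 1) : HasDerivWithinAt (fun u => γ (s + u * (t - s)))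
      ((t - s) • (γ (s + u * (t - s)) * c)) (Icc 0 1) u := by
    have h := (hv _ (hmaps u hu)).1.scomp u
      (((hasDerivAt_id u).mul_const (t - s)).const_add s).hasDerivWithinAt hmaps
    rwa [one_mul, mul_assoc] at h
  have h := dist_le_integral hτ (γ := fun u => γ (s + u * (t - s)))
    (f := fun _ => √(τ (c * c)).re * |t - s|)
    (fun u hu => hγ.mem_cone _ (hmaps u hu)) (fun u hu => (hd u hu).differentiableWithinAt)
    intervalIntegrable_const fun u hu => by
      obtain ⟨w, hw⟩ := (hγ.mem_cone _ (hmaps u hu)).2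
      have e : metric τ (↑w) (↑w * c) (↑w * c) = (τ (c * c)).re := by
        rw [metric, Ring.inverse_unit, mul_assoc, mul_assoc, mul_assoc, hτ.tracial]
        simp [mul_assoc]
      rw [speed_eq hu (hd u hu), metric_smul, ← hw, e, Real.sqrt_mul (sq_nonneg _),
        Real.sqrt_sq_eq_abs, mul_comm]
  simpa using h

end Geodesic

/-! ### From midpoint convexity to convexity, and the conclusion. -/

section Convexity

/-- If `f` exceeds a chord, the excess `g` has a leftmost maximizer `z` in the open interval. Around
`z` the left value is strictly smaller and the right value no larger, contradicting the midpoint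
inequality. -/
theorem convexOn_of_midpoint_of_lipschitz {I : Set ℝ} (hI : Convex ℝ I) {f : ℝ → ℝ} {K : ℝ}
    (hK : ∀ s ∈ I, ∀ t ∈ I, f s - f t ≤ K * |t - s|)
    (hmid : ∀ m r, 0 < r → m - r ∈ I → m + r ∈ I → f m ≤ 1 / 2 * f (m - r) + 1 / 2 * f (m + r)) :
    ConvexOn ℝ I f := by
  have hcont : ContinuousOn f I := by
    intro t ht
    rw [ContinuousWithinAt, tendsto_iff_dist_tendsto_zero]
    have hlim : Tendsto (fun s => K * |t - s|) (𝓝[I] t) (𝓝 0) := by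
      have h : Continuous fun s : ℝ => K * |t - s| := by fun_prop
      simpa using (h.tendsto t).mono_left nhdsWithin_le_nhds
    refine squeeze_zero' (Eventually.of_forall fun _ => dist_nonneg) ?_ hlim
    filter_upwards [self_mem_nhdsWithin] with s hs
    rw [Real.dist_eq, abs_le]
    have h1 := hK s hs t ht
    have h2 := hK t ht s hs
    rw [abs_sub_comm] at h2
    constructor <;> linarith
  refine LinearOrder.convexOn_of_lt hI fun x hx y hy hxy a b ha hb hab => ?_
  have hsub : Icc x y ⊆ I := hI.ordConnected.out hx hy
  set k : ℝ := (f y - f x) / (y - x)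
  have hk : k * (y - x) = f y - f x := div_mul_cancel₀ _ (sub_pos.2 hxy).ne'
  set g : ℝ → ℝ := fun t => f t - (f x + k * (t - x))
  have hgx : g x = 0 := by simp [g]
  have hgy : g y = 0 := by simp [g, hk]
  have hg : ContinuousOn g (Icc x y) := (hcont.mono hsub).sub (by fun_prop)
  suffices h : ∀ t ∈ Icc x y, g t ≤ 0 by
    have h1 := h (a • x + b • y) (convex_Icc x y ⟨le_rfl, hxy.le⟩ ⟨hxy.le, le_rfl⟩ ha.le hb.le hab)
    obtain rfl : a = 1 - b := eq_sub_of_add_eq hab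
    simp only [g, smul_eq_mul] at h1 ⊢
    linear_combination h1 + b * hk
  obtain ⟨p, hp, hmax⟩ := isCompact_Icc.exists_isMaxOn ⟨x, le_rfl, hxy.le⟩ hg
  intro t ht
  by_contra! hpos
  replace hpos : 0 < g p := hpos.trans_le (hmax ht)
  have hS : IsCompact (Icc x y ∩ g ⁻¹' {g p}) :=
    isCompact_Icc.of_isClosed_subset (hg.preimage_isClosed_of_isClosed isClosed_Icc
      isClosed_singleton) inter_subset_left
  obtain ⟨z, ⟨hz, hzp⟩, hleast⟩ := hS.exists_isLeast ⟨p, hp, rfl⟩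
  replace hzp : g z = g p := hzp
  have hxz : x < z := hz.1.lt_of_ne (by rintro rfl; linarith)
  have hzy : z < y := hz.2.lt_of_ne (by rintro rfl; linarith)
  set r := min (z - x) (y - z)
  have hr : 0 < r := lt_min (sub_pos.2 hxz) (sub_pos.2 hzy)
  have hr1 : r ≤ z - x := min_le_left _ _
  have hr2 : r ≤ y - z := min_le_right _ _
  have hl : z - r ∈ Icc x y := ⟨by linarith, by linarith⟩
  have hu : z + r ∈ Icc x y := ⟨by linarith, by linarith⟩
  have h1 := hmid z r hr (hsub hl) (hsub hu)
  have h2 : g (z - r) < g p := (hmax hl).lt_of_ne fun h => by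
    linarith [hleast ⟨hl, h⟩]
  have h3 : g (z + r) ≤ g p := hmax hu
  rw [← hzp] at h2 h3
  simp only [g] at h2 h3
  linarith

end Convexity

theorem convexOn_dist {A : Type*} [CStarAlgebra A] [PartialOrder A] [StarOrderedRing A]
    {τ : A →ₗ[ℂ] ℂ} (hτ : IsFiniteNormalFaithfulTrace τ) {I : Set ℝ} (hI : Convex ℝ I)
    {γ δ : ℝ → A} (hγ : IsGeodesicOn I γ) (hδ : IsGeodesicOn I δ) :
    ConvexOn ℝ I (fun t => dist τ (γ t) (δ t)) := by
  -- On a one-point interval `derivWithin` carries no information, but convexity is trivial there.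
  rcases (interior I).eq_empty_or_nonempty with hI' | hI'
  · have hsub : I.Subsingleton := by
      intro x hx y hy
      by_contra hne
      rcases lt_or_gt_of_ne hne with h | h
      · have := interior_mono (hI.ordConnected.out hx hy)
        rw [hI', interior_Icc] at this
        exact (nonempty_Ioo.2 h).not_subset_empty this
      · have := interior_mono (hI.ordConnected.out hy hx)
        rw [hI', interior_Icc] at this
        exact (nonempty_Ioo.2 h).not_subset_empty this
    refine ⟨hI, fun x hx y hy a b ha hb hab => ?_⟩
    obtain rfl := hsub hx hy
    rw [← add_smul, ← add_smul, hab, one_smul, one_smul]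
  obtain ⟨K, hK⟩ := hγ.exists_dist_le hτ hI hI'
  obtain ⟨K', hK'⟩ := hδ.exists_dist_le hτ hI hI'
  refine convexOn_of_midpoint_of_lipschitz (K := K + K') hI (fun s hs t ht => ?_)
    fun m r hr hl hu => ?_
  · have h1 := dist_triangle hτ (hγ.mem_cone s hs) (hγ.mem_cone t ht) (hδ.mem_cone s hs)
    have h2 := dist_triangle hτ (hγ.mem_cone t ht) (hδ.mem_cone t ht) (hδ.mem_cone s hs)
    have h3 := hK s hs t ht
    have h4 := hK' t ht s hs
    rw [abs_sub_comm] at h4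
    linarith
  · have hm : m ∈ I := hI.ordConnected.out hl hu ⟨by linarith, by linarith⟩
    -- `x` is the midpoint of a diagonal of the geodesic quadrilateral, which splits it into two
    -- triangles.
    obtain ⟨x, hx, hx1, hx2⟩ := exists_geometric_mean (hγ.mem_cone _ hl) (hδ.mem_cone _ hu)
    have h1 := dist_le_half_dist_reflection hτ (hγ.mem_cone m hm) hx (hγ.mem_cone _ hl)
    have h2 := dist_le_half_dist_reflection hτ hx (hδ.mem_cone m hm) (hδ.mem_cone _ hu)
    rw [(hγ.reflection hI hr hl hu).1, hx1] at h1
    rw [(hδ.reflection hI hr hl hu).2, hx2] at h2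
    have h3 := dist_triangle hτ (hγ.mem_cone m hm) hx (hδ.mem_cone m hm)
    linarith

end PositiveCone

/-! ### Von Neumann algebras as C*-algebras with the inherited order. -/

namespace VonNeumannAlgebra

variable {H : Type*} [NormedAddCommGroup H] [InnerProductSpace ℂ H] [CompleteSpace H]

theorem isClosed_coe (M : VonNeumannAlgebra H) :
    IsClosed (M.toStarSubalgebra : Set (H →L[ℂ] H)) := by
  rw [coe_toStarSubalgebra, ← M.centralizer_centralizer]
  exact Set.isClosed_centralizer _

/-- The square root commutes with whatever commutes with `x`, so it lies in the double commutant.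
This makes elements of `M` that are positive on `H` into squares inside `M`. -/
theorem sqrt_mem (M : VonNeumannAlgebra H) {x : H →L[ℂ] H} (hx : x ∈ M) : CFC.sqrt x ∈ M := by
  rw [← M.commutant_commutant, mem_commutant_iff]
  intro y hy
  rw [mem_commutant_iff] at hy
  have : Commute x y := hy x hx
  exact (Commute.cfcₙ_nnreal this NNReal.sqrt).symm

theorem starOrderedRing (M : VonNeumannAlgebra H) : StarOrderedRing M.toStarSubalgebra :=
  .of_nonneg_iff' (fun {x y} h z => add_le_add_right (α := H →L[ℂ] H) h z) fun x => by
    constructor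
    · intro hx
      have hx' : (0 : H →L[ℂ] H) ≤ x := hx
      refine ⟨⟨CFC.sqrt (x : H →L[ℂ] H), M.sqrt_mem x.2⟩, Subtype.ext ?_⟩
      change (x : H →L[ℂ] H) = star (CFC.sqrt (x : H →L[ℂ] H)) * CFC.sqrt (x : H →L[ℂ] H)
      rw [(CFC.sqrt_nonneg (x : H →L[ℂ] H)).isSelfAdjoint.star_eq, CFC.sqrt_mul_sqrt_self _ hx']
    · rintro ⟨s, rfl⟩
      exact star_mul_self_nonneg (s : H →L[ℂ] H)

end VonNeumannAlgebra

theorem mainTheorem2 {H : Type*} [NormedAddCommGroup H] [InnerProductSpace ℂ H] [CompleteSpace H]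
    (M : VonNeumannAlgebra H) (τ : M.toStarSubalgebra →ₗ[ℂ] ℂ)
    (hτ : PositiveCone.IsFiniteNormalFaithfulTrace τ)
    (I : Set ℝ) (hI : Convex ℝ I) (γ δ : ℝ → M.toStarSubalgebra)
    (hγ : PositiveCone.IsGeodesicOn I γ) (hδ : PositiveCone.IsGeodesicOn I δ) :
    ConvexOn ℝ I (fun t => PositiveCone.dist τ (γ t) (δ t)) := by
  have := M.isClosed_coe
  have := M.starOrderedRing
  exact PositiveCone.convexOn_dist (A := M.toStarSubalgebra) hτ hI hγ hδ
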